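/- Let $k$ be an algebraically closed field of characteristic $0$ and let $n\ge 2$. Let $C_n=\langle a\rangle\le S_n$ be generated by the standard $n$-cycle $a=(1\,2\,\cdots\,n)$ and regard $S_{n-1}$ as the subgroup of $S_n$ fixing $n$, so that $S_n=C_nS_{n-1}$ and $C_n\cap S_{n-1}=1$. For $x\in S_{n-1}$ and $b\in C_n$ define $x\rhd b\in C_n$ and $x\lhd b\in S_{n-1}$ by $xb=(x\rhd b)(x\lhd b)$. Let $J_n=k^{S_{n-1}}\#kC_n$ be the resulting bismash product, i.e. the Hopf algebra with basis $p_x\#b$ ($x\in S_{n-1}$, $b\in C_n$), multiplication $(p_x\#b)(p_y\#c)=\delta_{y,\,x\lhd b}\,p_x\#bc$, unit $\sum_x p_x\#1$, counit $\varepsilon(p_x\#b)=\delta_{x,1}$, comultiplication $\Delta(p_x\#b)=\sum_{y}(p_{xy^{-1}}\#(y\rhd b))\otimes(p_y\#b)$ and antipode $S(p_x\#b)=p_{(x\lhd b)^{-1}}\#(x\rhd b)^{-1}$. Then $J_n$ is totally orthogonal if and only if $n=2$. Here totally orthogonal means that every simple $J_n$-module admits a symmetric nondegenerate bilinear form $B$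 that is $J_n$-invariant, i.e. $\sum B(h_1v,h_2w)=\varepsilon(h)B(v,w)$ for all $h\in J_n$. Likewise, $n=2$ if and only if all simple $J_n$-modules have Frobenius–Schur indicator $\nu(\chi)=\chi\big(\sum\Lambda_1\Lambda_2\big)$ equal to $+1$, where $\chi$ is the character of the module and $\Lambda$ is the two-sided integral of $J_n$ with $\varepsilon(\Lambda)=1$. -/

import Mathlib

open scoped TensorProduct

/-! ### Matched pairs of groups and the bismash product -/

/-- A matched pair of groups `(F, G, ▷, ◁)`: `rhd x a = x ▷ a` is a left action of the group `G` on
the set `F`, `lhd x a = x ◁ a` is a right action of the group `F` on the set `G`, and the two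
actions satisfy the two compatibility laws. -/
structure MatchedPair (F G : Type*) [Group F] [Group G] where
  rhd : G → F → F
  lhd : G → F → G
  one_rhd : ∀ a, rhd 1 a = a
  mul_rhd : ∀ x y a, rhd (x * y) a = rhd x (rhd y a)
  lhd_one : ∀ x, lhd x 1 = x
  lhd_mul : ∀ x a b, lhd x (a * b) = lhd (lhd x a) b
  rhd_mul : ∀ x a b, rhd x (a * b) = rhd x a * rhd (lhd x a) b
  mul_lhd : ∀ x y a, lhd (x * y) a = lhd x (rhd y a) * lhd y a

namespace MatchedPair

section
variable {F G : Type*} [Group F] [Group G] (P : MatchedPair F G)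

theorem rhd_one (x : G) : P.rhd x 1 = 1 := by
  have h := P.rhd_mul x 1 1
  rw [P.lhd_one, mul_one] at h
  exact left_eq_mul.mp h

theorem one_lhd (a : F) : P.lhd 1 a = 1 := by
  have h := P.mul_lhd 1 1 a
  rw [P.one_rhd, mul_one] at h
  exact left_eq_mul.mp h

theorem rhd_inv_rhd (x : G) (a : F) : P.rhd x (P.rhd x⁻¹ a) = a := by
  rw [← P.mul_rhd, mul_inv_cancel, P.one_rhd]

theorem inv_rhd_rhd (x : G) (a : F) : P.rhd x⁻¹ (P.rhd x a) = a := by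
  rw [← P.mul_rhd, inv_mul_cancel, P.one_rhd]

theorem lhd_lhd_inv (x : G) (a : F) : P.lhd (P.lhd x a) a⁻¹ = x := by
  rw [← P.lhd_mul, mul_inv_cancel, P.lhd_one]

theorem lhd_inv_lhd (x : G) (a : F) : P.lhd (P.lhd x a⁻¹) a = x := by
  rw [← P.lhd_mul, inv_mul_cancel, P.lhd_one]

theorem lhd_eq_one (x : G) (a : F) : P.lhd x a = 1 ↔ x = 1 := by
  refine ⟨fun h => ?_, fun h => by rw [h, P.one_lhd]⟩
  rw [← P.lhd_lhd_inv x a, h, P.one_lhd]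

theorem inv_lhd (x : G) (a : F) : (P.lhd x a)⁻¹ = P.lhd x⁻¹ (P.rhd x a) := by
  have h := P.mul_lhd x⁻¹ x a
  rw [inv_mul_cancel, P.one_lhd] at h
  exact inv_eq_of_mul_eq_one_left h.symm

/-- The matched pair of a factorizable group `L = F G` with `F ∩ G = 1`: the elements `x ▷ b ∈ F`
and `x ◁ b ∈ G` are the unique ones with `x b = (x ▷ b) (x ◁ b)`. -/
noncomputable def ofIsComplement {L : Type*} [Group L] {F G : Subgroup L}
    (h : Subgroup.IsComplement' F G) : MatchedPair F G :=
  have key : ∀ (a a' : F) (x x' : G), (a : L) * x = a' * x' → a = a' ∧ x = x' := by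
    intro a a' x x' e
    have := h.injective (a₁ := (a, x)) (a₂ := (a', x')) e
    exact Prod.mk.inj this
  have spec : ∀ (x : G) (b : F), ((Subgroup.IsComplement.equiv h ((x : L) * b)).1 : L)
      * ((Subgroup.IsComplement.equiv h ((x : L) * b)).2 : L) = x * b :=
    fun x b => Subgroup.IsComplement.equiv_fst_mul_equiv_snd h _
  have uniq : ∀ (x : G) (b a' : F) (x' : G), (a' : L) * x' = x * b →
      (Subgroup.IsComplement.equiv h ((x : L) * b)).1 = a' ∧
      (Subgroup.IsComplement.equiv h ((x : L) * b)).2 = x' :=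
    fun x b a' x' e => key _ _ _ _ ((spec x b).trans e.symm)
  have mulG : ∀ (x y : G) (b : F), _ := fun x y b => uniq (x * y) b
    (Subgroup.IsComplement.equiv h ((x : L) *
      (Subgroup.IsComplement.equiv h ((y : L) * b)).1)).1
    ((Subgroup.IsComplement.equiv h ((x : L) *
      (Subgroup.IsComplement.equiv h ((y : L) * b)).1)).2 *
      (Subgroup.IsComplement.equiv h ((y : L) * b)).2) (by
    push_cast
    rw [← mul_assoc, spec, mul_assoc, spec, mul_assoc])
  have mulF : ∀ (x : G) (b c : F), _ := fun x b c => uniq x (b * c)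
    ((Subgroup.IsComplement.equiv h ((x : L) * b)).1 *
      (Subgroup.IsComplement.equiv h
        (((Subgroup.IsComplement.equiv h ((x : L) * b)).2 : L) * c)).1)
    (Subgroup.IsComplement.equiv h
        (((Subgroup.IsComplement.equiv h ((x : L) * b)).2 : L) * c)).2 (by
    push_cast
    rw [mul_assoc, spec, ← mul_assoc, spec, mul_assoc])
  { rhd := fun x b => (Subgroup.IsComplement.equiv h ((x : L) * b)).1
    lhd := fun x b => (Subgroup.IsComplement.equiv h ((x : L) * b)).2
    one_rhd := fun a => (uniq 1 a a 1 (by simp)).1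
    mul_rhd := fun x y b => (mulG x y b).1
    lhd_one := fun x => (uniq x 1 1 x (by simp)).2
    lhd_mul := fun x b c => (mulF x b c).2
    rhd_mul := fun x b c => (mulF x b c).1
    mul_lhd := fun x y b => (mulG x y b).2 }

end

end MatchedPair

/-- The vector space `k^G ⊗ kF` underlying the bismash product `k^G # kF`: the space with basis
`p_x # a` for `x ∈ G`, `a ∈ F`. -/
def Bismash (k : Type*) [Field k] {F G : Type*} [Group F] [Group G]
    (_P : MatchedPair F G) : Type _ :=
  (G × F) →₀ k

namespace Bismash

section
variable (k : Type*) [Field k] {F G : Type*} [Group F] [Group G] (P : MatchedPair F G)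

noncomputable instance : AddCommGroup (Bismash k P) :=
  inferInstanceAs (AddCommGroup ((G × F) →₀ k))

noncomputable instance : Module k (Bismash k P) :=
  inferInstanceAs (Module k ((G × F) →₀ k))

/-- The basis `(p_x # a)` of the bismash product, indexed by the pairs `(x, a)`. -/
noncomputable def basis : Module.Basis (G × F) k (Bismash k P) :=
  Finsupp.basisSingleOne

/-- The basis element `p_x # a`. -/
noncomputable def pb (x : G) (a : F) : Bismash k P :=
  basis k P (x, a)

open Classical in
/-- Multiplication as a bilinear map: `(p_x # a) (p_y # b) = δ_{y, x ◁ a} p_x # ab`. -/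
noncomputable def mulMap : Bismash k P →ₗ[k] Bismash k P →ₗ[k] Bismash k P :=
  (basis k P).constr k fun s => (basis k P).constr k fun t =>
    if t.1 = P.lhd s.1 s.2 then pb k P s.1 (s.2 * t.2) else 0

noncomputable instance : Mul (Bismash k P) :=
  ⟨fun u v => mulMap k P u v⟩

open Classical in
theorem pb_mul_pb (x y : G) (a b : F) :
    pb k P x a * pb k P y b = if y = P.lhd x a then pb k P x (a * b) else 0 := by
  change mulMap k P (pb k P x a) (pb k P y b) = _
  simp only [mulMap, pb, Module.Basis.constr_basis]

variable {k P} in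
theorem induction_pb {p : Bismash k P → Prop} (u : Bismash k P) (h0 : p 0)
    (hadd : ∀ u v, p u → p v → p (u + v)) (hb : ∀ (c : k) x a, p (c • pb k P x a)) : p u := by
  refine Finsupp.induction_linear u h0 hadd fun s c => ?_
  have h : (Finsupp.single s c : (G × F) →₀ k) = c • Finsupp.single s 1 := by simp
  exact h ▸ hb c s.1 s.2

theorem mul_eq (u v : Bismash k P) : u * v = mulMap k P u v := rfl

theorem add_mul' (u v w : Bismash k P) : (u + v) * w = u * w + v * w := by
  simp only [mul_eq, map_add, LinearMap.add_apply]

theorem mul_add' (u v w : Bismash k P) : u * (v + w) = u * v + u * w := by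
  simp only [mul_eq, map_add]

theorem smul_mul' (c : k) (u v : Bismash k P) : (c • u) * v = c • (u * v) := by
  simp only [mul_eq, map_smul, LinearMap.smul_apply]

theorem mul_smul' (c : k) (u v : Bismash k P) : u * (c • v) = c • (u * v) := by
  simp only [mul_eq, map_smul]

theorem zero_mul' (u : Bismash k P) : 0 * u = 0 := by
  simp only [mul_eq, map_zero, LinearMap.zero_apply]

theorem mul_zero' (u : Bismash k P) : u * 0 = 0 := by
  simp only [mul_eq, map_zero]

theorem sum_mul' {ι : Type*} (s : Finset ι) (f : ι → Bismash k P) (u : Bismash k P) :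
    (∑ i ∈ s, f i) * u = ∑ i ∈ s, f i * u := by
  simp only [mul_eq, map_sum, LinearMap.sum_apply]

theorem mul_sum' {ι : Type*} (s : Finset ι) (f : ι → Bismash k P) (u : Bismash k P) :
    u * (∑ i ∈ s, f i) = ∑ i ∈ s, u * f i := by
  simp only [mul_eq, map_sum]

theorem mul_assoc' (u v w : Bismash k P) : u * v * w = u * (v * w) := by
  induction u using induction_pb with
  | h0 => simp only [zero_mul']
  | hadd u u' hu hu' => simp only [add_mul', hu, hu']
  | hb c x a =>
  induction v using induction_pb with
  | h0 => simp only [zero_mul', mul_zero']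
  | hadd u u' hu hu' => simp only [add_mul', mul_add', hu, hu']
  | hb d y b =>
  induction w using induction_pb with
  | h0 => simp only [mul_zero']
  | hadd u u' hu hu' => simp only [mul_add', hu, hu']
  | hb e z f =>
  simp only [smul_mul', mul_smul', pb_mul_pb]
  by_cases h1 : y = P.lhd x a <;> by_cases h2 : z = P.lhd y b <;>
    simp_all [pb_mul_pb, zero_mul', mul_zero', mul_assoc, P.lhd_mul]

end

section
variable (k : Type*) [Field k] {F G : Type*} [Group F] [Group G] [Fintype G]
  (P : MatchedPair F G)

/-- The unit is `1 # 1`, where `1 = ∑ x, p_x` is the unit of `k^G`. -/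
noncomputable instance : One (Bismash k P) :=
  ⟨∑ x : G, pb k P x 1⟩

theorem one_eq : (1 : Bismash k P) = ∑ x : G, pb k P x 1 := rfl

theorem one_mul' (u : Bismash k P) : 1 * u = u := by
  induction u using induction_pb with
  | h0 => simp only [mul_zero']
  | hadd u u' hu hu' => simp only [mul_add', hu, hu']
  | hb c x a =>
    classical
    simp [mul_smul', one_eq, sum_mul', pb_mul_pb, P.lhd_one]

theorem mul_one' (u : Bismash k P) : u * 1 = u := by
  induction u using induction_pb with
  | h0 => simp only [zero_mul']
  | hadd u u' hu hu' => simp only [add_mul', hu, hu']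
  | hb c x a =>
    classical
    simp [smul_mul', one_eq, mul_sum', pb_mul_pb]

noncomputable instance : Ring (Bismash k P) :=
  { (inferInstance : AddCommGroup (Bismash k P)) with
    mul := (· * ·)
    one := 1
    left_distrib := mul_add' k P
    right_distrib := add_mul' k P
    zero_mul := zero_mul' k P
    mul_zero := mul_zero' k P
    mul_assoc := mul_assoc' k P
    one_mul := one_mul' k P
    mul_one := mul_one' k P }

noncomputable instance : Algebra k (Bismash k P) :=
  Algebra.ofModule (smul_mul' k P) (mul_smul' k P)

open Classical in
/-- Counit `ε(p_x # a) = δ_{x,1}` and comultiplication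
`Δ(p_x # a) = ∑ y, (p_{x y⁻¹} # (y ▷ a)) ⊗ (p_y # a)`. -/
noncomputable instance : CoalgebraStruct k (Bismash k P) where
  counit := (basis k P).constr k fun s => if s.1 = 1 then 1 else 0
  comul := (basis k P).constr k fun s =>
    ∑ y : G, pb k P (s.1 * y⁻¹) (P.rhd y s.2) ⊗ₜ[k] pb k P y s.2

open Classical in
theorem counit_pb (x : G) (a : F) :
    Coalgebra.counit (R := k) (pb k P x a) = if x = 1 then 1 else 0 :=
  (basis k P).constr_basis k _ (x, a)

theorem comul_pb (x : G) (a : F) : Coalgebra.comul (R := k) (pb k P x a) =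
    ∑ y : G, pb k P (x * y⁻¹) (P.rhd y a) ⊗ₜ[k] pb k P y a :=
  (basis k P).constr_basis k _ (x, a)

variable {k P} in
theorem ext_pb {M : Type*} [AddCommMonoid M] [Module k M] {f g : Bismash k P →ₗ[k] M}
    (h : ∀ x a, f (pb k P x a) = g (pb k P x a)) : f = g :=
  (basis k P).ext fun s => h s.1 s.2

noncomputable instance : Coalgebra k (Bismash k P) where
  coassoc := by
    refine ext_pb fun x a => ?_
    simp only [LinearMap.comp_apply, LinearEquiv.coe_coe, comul_pb, map_sum,
      LinearMap.rTensor_tmul, LinearMap.lTensor_tmul, TensorProduct.sum_tmul,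
      TensorProduct.tmul_sum, TensorProduct.assoc_tmul]
    refine Eq.trans ?_ Finset.sum_comm
    refine Finset.sum_congr rfl fun y _ => ?_
    refine Fintype.sum_equiv (Equiv.mulRight y) _ _ fun z => ?_
    simp [P.mul_rhd, mul_assoc]
  rTensor_counit_comp_comul := by
    refine ext_pb fun x a => ?_
    simp only [LinearMap.comp_apply, comul_pb, map_sum, LinearMap.rTensor_tmul, counit_pb,
      TensorProduct.mk_apply]
    rw [Finset.sum_eq_single x]
    · simp
    · intro y _ hy
      rw [if_neg (fun h => hy (mul_inv_eq_one.mp h).symm), TensorProduct.zero_tmul]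
    · simp
  lTensor_counit_comp_comul := by
    refine ext_pb fun x a => ?_
    simp only [LinearMap.comp_apply, comul_pb, map_sum, LinearMap.lTensor_tmul, counit_pb,
      LinearMap.flip_apply, TensorProduct.mk_apply]
    rw [Finset.sum_eq_single 1]
    · simp [P.one_rhd]
    · intro y _ hy
      rw [if_neg hy, TensorProduct.tmul_zero]
    · simp

theorem counit_mul' (u v : Bismash k P) : Coalgebra.counit (R := k) (u * v) =
    Coalgebra.counit (R := k) u * Coalgebra.counit (R := k) v := by
  classical
  induction u using induction_pb with
  | h0 => simp only [zero_mul, map_zero]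
  | hadd u u' hu hu' => simp only [add_mul, map_add, hu, hu']
  | hb c x a =>
  induction v using induction_pb with
  | h0 => simp only [mul_zero, map_zero]
  | hadd u u' hu hu' => simp only [mul_add, map_add, hu, hu']
  | hb d y b =>
  simp only [smul_mul_assoc, mul_smul_comm, map_smul, pb_mul_pb, counit_pb]
  by_cases hx : x = 1
  · subst hx
    by_cases hy : y = 1 <;> simp [hy, P.one_lhd, counit_pb]
  · by_cases h : y = P.lhd x a <;> simp [h, hx, counit_pb]

theorem comul_mul' (u v : Bismash k P) : Coalgebra.comul (R := k) (u * v) =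
    Coalgebra.comul (R := k) u * Coalgebra.comul (R := k) v := by
  classical
  induction u using induction_pb with
  | h0 => simp only [zero_mul, map_zero]
  | hadd u u' hu hu' => simp only [add_mul, map_add, hu, hu']
  | hb c x a =>
  induction v using induction_pb with
  | h0 => simp only [mul_zero, map_zero]
  | hadd u u' hu hu' => simp only [mul_add, map_add, hu, hu']
  | hb d y b =>
  simp only [smul_mul_assoc, mul_smul_comm, map_smul]
  congr 2
  simp only [comul_pb, Finset.sum_mul, Finset.mul_sum,
    Algebra.TensorProduct.tmul_mul_tmul, pb_mul_pb]
  rw [Finset.sum_comm]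
  by_cases h : y = P.lhd x a
  · rw [if_pos h, comul_pb]
    refine Finset.sum_congr rfl fun z _ => ?_
    rw [Finset.sum_eq_single (P.lhd z a)]
    · have e : y * (P.lhd z a)⁻¹ = P.lhd (x * z⁻¹) (P.rhd z a) := by
        rw [h, mul_inv_eq_iff_eq_mul, ← P.mul_lhd, inv_mul_cancel_right]
      rw [if_pos e, if_pos rfl, P.rhd_mul]
    · intro w _ hw
      rw [if_neg hw, TensorProduct.tmul_zero]
    · simp
  · rw [if_neg h, map_zero]
    refine (Finset.sum_eq_zero fun z _ => Finset.sum_eq_zero fun w _ => ?_).symm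
    by_cases hw : w = P.lhd z a
    · rw [if_neg (c := y * w⁻¹ = _), TensorProduct.zero_tmul]
      intro e
      refine h ?_
      rw [hw, mul_inv_eq_iff_eq_mul, ← P.mul_lhd, inv_mul_cancel_right] at e
      exact e
    · rw [if_neg hw, TensorProduct.tmul_zero]

theorem counit_one' : Coalgebra.counit (R := k) (1 : Bismash k P) = 1 := by
  classical
  simp [one_eq, counit_pb]

theorem comul_one' : Coalgebra.comul (R := k) (1 : Bismash k P) = 1 := by
  rw [Algebra.TensorProduct.one_def]
  simp only [one_eq, map_sum, comul_pb, TensorProduct.tmul_sum, TensorProduct.sum_tmul,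
    P.rhd_one]
  rw [Finset.sum_comm]
  exact Finset.sum_congr rfl fun y _ =>
    Fintype.sum_equiv (Equiv.mulRight y⁻¹) _ _ fun z => rfl

noncomputable instance : Bialgebra k (Bismash k P) :=
  Bialgebra.mk' k (Bismash k P) (counit_one' k P) (@fun u v => counit_mul' k P u v)
    (comul_one' k P) (@fun u v => comul_mul' k P u v)

/-- The antipode `S(p_x # a) = p_{(x ◁ a)⁻¹} # (x ▷ a)⁻¹`. -/
noncomputable instance : HopfAlgebraStruct k (Bismash k P) where
  antipode := (basis k P).constr k fun s =>
    pb k P (P.lhd s.1 s.2)⁻¹ (P.rhd s.1 s.2)⁻¹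

theorem antipode_pb (x : G) (a : F) : HopfAlgebraStruct.antipode k (pb k P x a) =
    pb k P (P.lhd x a)⁻¹ (P.rhd x a)⁻¹ :=
  (basis k P).constr_basis k _ (x, a)

/-- The bismash product `k^G # kF` as a Hopf algebra. -/
noncomputable instance : HopfAlgebra k (Bismash k P) where
  mul_antipode_rTensor_comul := by
    classical
    refine ext_pb fun x a => ?_
    simp only [LinearMap.comp_apply, comul_pb, map_sum, LinearMap.rTensor_tmul, antipode_pb,
      LinearMap.mul'_apply, pb_mul_pb, counit_pb, Algebra.linearMap_apply, ← P.mul_rhd,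
      inv_mul_cancel_right]
    have e : ∀ y : G, P.lhd (P.lhd (x * y⁻¹) (P.rhd y a))⁻¹ (P.rhd x a)⁻¹ = y * x⁻¹ := by
      intro y
      rw [P.inv_lhd, ← P.mul_rhd, inv_mul_cancel_right, P.lhd_lhd_inv, mul_inv_rev, inv_inv]
    simp only [e, left_eq_mul, inv_eq_one]
    by_cases h : x = 1
    · subst h
      simp only [if_true, map_one, one_eq, P.one_rhd, inv_mul_cancel, one_mul, P.inv_lhd,
        inv_inv, P.inv_rhd_rhd]
      let f : G ≃ G := ⟨fun y => P.lhd y a, fun y => P.lhd y a⁻¹,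
        fun y => P.lhd_lhd_inv y a, fun y => P.lhd_inv_lhd y a⟩
      exact Fintype.sum_equiv f _ _ fun y => rfl
    · simp [h]
  mul_antipode_lTensor_comul := by
    classical
    refine ext_pb fun x a => ?_
    simp only [LinearMap.comp_apply, comul_pb, map_sum, LinearMap.lTensor_tmul, antipode_pb,
      LinearMap.mul'_apply, pb_mul_pb, counit_pb, Algebra.linearMap_apply, mul_inv_cancel]
    have e : ∀ y : G, (P.lhd y a)⁻¹ = P.lhd (x * y⁻¹) (P.rhd y a) ↔ x = 1 := by
      intro y
      rw [P.inv_lhd]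
      refine ⟨fun h => ?_, fun h => by rw [h, one_mul]⟩
      have h' := congrArg (fun z => P.lhd z (P.rhd y a)⁻¹) h
      simpa only [P.lhd_lhd_inv, right_eq_mul] using h'
    simp only [e]
    by_cases h : x = 1
    · subst h
      simp only [if_true, map_one, one_eq, one_mul]
      exact Fintype.sum_equiv (Equiv.inv G) _ _ fun y => rfl
    · simp [h]

end

end Bismash

/-! ### Indicators and totally orthogonal Hopf algebras -/

section
variable (k : Type*) (H : Type*) [Field k] [Ring H] [HopfAlgebra k H]

/-- `Λ` is the normalized two-sided integral of `H`: `h Λ = ε(h) Λ = Λ h` for all `h`, and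
`ε(Λ) = 1`. -/
structure IsNormalizedIntegral (Λ : H) : Prop where
  mul_left : ∀ h : H, h * Λ = Coalgebra.counit (R := k) h • Λ
  mul_right : ∀ h : H, Λ * h = Coalgebra.counit (R := k) h • Λ
  counit_eq : Coalgebra.counit (R := k) Λ = 1

variable {k H} in
theorem IsNormalizedIntegral.unique {Λ Λ' : H} (h : IsNormalizedIntegral k H Λ)
    (h' : IsNormalizedIntegral k H Λ') : Λ = Λ' := by
  have h1 := h.mul_right Λ'
  have h2 := h'.mul_left Λ
  rw [h'.counit_eq, one_smul] at h1
  rw [h.counit_eq, one_smul] at h2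
  exact h1.symm.trans h2

open Classical in
/-- The normalized two-sided integral of `H`. It is unique when it exists, and it exists when
`H` is semisimple. The value `0` is used when there is none. -/
noncomputable def normalizedIntegral : H :=
  if h : ∃ Λ : H, IsNormalizedIntegral k H Λ then h.choose else 0

variable {k H} in
theorem IsNormalizedIntegral.eq_normalizedIntegral {Λ : H} (h : IsNormalizedIntegral k H Λ) :
    normalizedIntegral k H = Λ := by
  have hex : ∃ Λ : H, IsNormalizedIntegral k H Λ := ⟨Λ, h⟩
  rw [normalizedIntegral, dif_pos hex]
  exact hex.choose_spec.unique h

/-- The (second) Frobenius-Schur indicator of an `H`-module `M` with character `χ`: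
`ν(χ) = χ(∑ Λ₁ Λ₂)`, where `Λ` is the normalized integral and `∑ Λ₁ ⊗ Λ₂ = Δ(Λ)`. -/
noncomputable def frobeniusSchurIndicator (M : Type*) [AddCommGroup M] [Module k M] [Module H M]
    [IsScalarTower k H M] : k :=
  LinearMap.trace k M (Algebra.lsmul k k M
    (LinearMap.mul' k H (Coalgebra.comul (R := k) (normalizedIntegral k H))))

/-- A bilinear form `B` on an `H`-module is `H`-invariant if
`∑ B (h₁ v) (h₂ w) = ε(h) B v w`, where `∑ h₁ ⊗ h₂ = Δ(h)`. -/
def IsInvariantForm {M : Type*} [AddCommGroup M] [Module k M] [Module H M]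
    [IsScalarTower k H M] (B : LinearMap.BilinForm k M) : Prop :=
  ∀ (h : H) (v w : M),
    TensorProduct.lift
      (B.compl₁₂ ((LinearMap.toSpanSingleton H M v).restrictScalars k)
        ((LinearMap.toSpanSingleton H M w).restrictScalars k))
      (Coalgebra.comul (R := k) h) = Coalgebra.counit (R := k) h * B v w

end

universe u v

/-- `H` is totally orthogonal if every simple `H`-module admits an `H`-invariant, symmetric,
nondegenerate bilinear form. (Every simple module is a quotient of `H`, so it is enough to consider
modules in the universe of `H`.) -/
def IsTotallyOrthogonal (k : Type u) (H : Type v) [Field k] [Ring H] [HopfAlgebra k H] : Prop :=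
  ∀ (M : Type v) [AddCommGroup M] [Module k M] [Module H M] [IsScalarTower k H M]
    [IsSimpleModule H M],
    ∃ B : LinearMap.BilinForm k M, IsInvariantForm k H B ∧ B.IsSymm ∧ B.Nondegenerate

/-- All simple `H`-modules have Frobenius-Schur indicator `+1`. -/
def AllIndicatorsOne (k : Type u) (H : Type v) [Field k] [Ring H] [HopfAlgebra k H] : Prop :=
  ∀ (M : Type v) [AddCommGroup M] [Module k M] [Module H M] [IsScalarTower k H M]
    [IsSimpleModule H M], frobeniusSchurIndicator k H M = 1

/-- The normalized integral of `k^G # kF` is `|F|⁻¹ ∑ a, p_1 # a`. -/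
theorem Bismash.isNormalizedIntegral (k : Type*) [Field k] {F G : Type*} [Group F] [Group G]
    [Fintype F] [Fintype G] (P : MatchedPair F G) (hF : (Fintype.card F : k) ≠ 0) :
    IsNormalizedIntegral k (Bismash k P)
      ((Fintype.card F : k)⁻¹ • ∑ a : F, Bismash.pb k P 1 a) where
  mul_left h := by
    classical
    induction h using Bismash.induction_pb with
    | h0 => simp only [zero_mul, map_zero, zero_smul]
    | hadd u v hu hv => simp only [add_mul, map_add, add_smul, hu, hv]
    | hb c x b =>
      simp only [mul_smul_comm, smul_mul_assoc, Finset.mul_sum, Bismash.pb_mul_pb, map_smul,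
        Bismash.counit_pb, smul_eq_mul, eq_comm (a := (1 : G)), P.lhd_eq_one]
      by_cases hx : x = 1
      · subst hx
        simp only [if_true, mul_one]
        rw [smul_comm c, ← Finset.smul_sum,
          show ∑ a : F, Bismash.pb k P 1 (b * a) = ∑ a : F, Bismash.pb k P 1 a from
            Fintype.sum_equiv (Equiv.mulLeft b) _ _ fun a => rfl]
      · simp [hx]
  mul_right h := by
    classical
    induction h using Bismash.induction_pb with
    | h0 => simp only [mul_zero, map_zero, zero_smul]
    | hadd u v hu hv => simp only [mul_add, map_add, add_smul, hu, hv]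
    | hb c x b =>
      simp only [mul_smul_comm, smul_mul_assoc, Finset.sum_mul, Bismash.pb_mul_pb, map_smul,
        Bismash.counit_pb, smul_eq_mul, P.one_lhd]
      by_cases hx : x = 1
      · subst hx
        simp only [if_true, mul_one]
        rw [show ∑ a : F, Bismash.pb k P 1 (a * b) = ∑ a : F, Bismash.pb k P 1 a from
            Fintype.sum_equiv (Equiv.mulRight b) _ _ fun a => rfl]
      · simp [hx]
  counit_eq := by
    classical
    simp [Bismash.counit_pb, hF]

/-! ### The Hopf algebra `J_n`

The symmetric group `S_n` is the group of permutations of `ZMod n`: the point `i ∈ {1, …, n}` is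
represented by its residue class, so `n` is represented by `0`. -/

section
variable (n : ℕ)

/-- The standard `n`-cycle `a = (1 2 ⋯ n)`, that is `i ↦ i + 1`. -/
def stdCycle : Equiv.Perm (ZMod n) := Equiv.addRight 1

/-- The subgroup `C_n = ⟨a⟩` of `S_n`. -/
def cyclicSubgroup : Subgroup (Equiv.Perm (ZMod n)) := Subgroup.zpowers (stdCycle n)

/-- The subgroup `S_{n-1}` of `S_n`: the permutations that fix the point `n` (that is `0`). -/
def pointStabilizer : Subgroup (Equiv.Perm (ZMod n)) :=
  MulAction.stabilizer (Equiv.Perm (ZMod n)) (0 : ZMod n)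

theorem stdCycle_zpow_apply (r : ℤ) (i : ZMod n) : (stdCycle n ^ r) i = i + r := by
  induction r with
  | zero => simp
  | succ r ih =>
    have h : (stdCycle n) (i + ((r : ℤ) : ZMod n)) = i + ((r : ℤ) : ZMod n) + 1 := rfl
    rw [add_comm (r : ℤ) 1, zpow_add, zpow_one, Equiv.Perm.mul_apply, ih, h]
    push_cast
    ring
  | pred r ih =>
    have h : (stdCycle n)⁻¹ (i + ((-(r : ℤ) : ℤ) : ZMod n)) = i + ((-(r : ℤ) : ℤ) : ZMod n) - 1 := by
      rw [Equiv.Perm.inv_eq_iff_eq]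
      exact (sub_add_cancel _ _).symm
    rw [sub_eq_add_neg, add_comm, zpow_add, zpow_neg_one, Equiv.Perm.mul_apply, ih, h]
    push_cast
    ring

/-- `S_n = C_n S_{n-1}` with `C_n ∩ S_{n-1} = 1`. -/
theorem isComplement_cyclicSubgroup :
    Subgroup.IsComplement' (cyclicSubgroup n) (pointStabilizer n) := by
  refine Subgroup.isComplement'_stabilizer (0 : ZMod n) ?_ ?_
  · rintro ⟨h, r, rfl⟩ h0
    have h1 : (stdCycle n ^ r) (0 : ZMod n) = 0 := h0
    rw [stdCycle_zpow_apply, zero_add] at h1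
    refine Subtype.ext (Equiv.ext fun i => ?_)
    change (stdCycle n ^ r) i = i
    rw [stdCycle_zpow_apply, h1, add_zero]
  · intro g
    obtain ⟨r, hr⟩ := ZMod.intCast_surjective (g 0)
    refine ⟨⟨stdCycle n ^ (-r), -r, rfl⟩, ?_⟩
    change (stdCycle n ^ (-r)) (g 0) = 0
    rw [stdCycle_zpow_apply, ← hr]
    push_cast
    ring

/-- The matched pair `(C_n, S_{n-1}, ▷, ◁)` of the factorization `S_n = C_n S_{n-1}`. -/
noncomputable def matchedPairJ : MatchedPair (cyclicSubgroup n) (pointStabilizer n) :=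
  MatchedPair.ofIsComplement (isComplement_cyclicSubgroup n)

noncomputable instance [NeZero n] : Fintype (cyclicSubgroup n) := Fintype.ofFinite _

noncomputable instance [NeZero n] : Fintype (pointStabilizer n) := Fintype.ofFinite _

/-- The bismash product `J_n = k^{S_{n-1}} # kC_n`. -/
abbrev HopfJ (k : Type*) [Field k] : Type _ := Bismash k (matchedPairJ n)

end

/-! Since `1` is fixed by the right action of F on G, each character φ of F gives an algebra map
from k^G # kF to k, sending p_x # b to δ_{x,1} φ(b), and hence a one-dimensional simple module
(`charHom`, `charModule_isSimpleModule`). An invariant form on this module is scaled by φ(a)² under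
p_1 # a, so a nonzero one forces φ² = 1. Its indicator is the mean of φ(a²) over F, which is 0 by
orthogonality unless φ² = 1. For n > 2 the square of the n-cycle is nontrivial, and the finite
abelian group C_n has a character taking a value other than 1 on it; this refutes both properties at
once.

For n = 2 the group S_1 is trivial, so J_2 is the group algebra of C_2. Its basis elements are
central group-likes of square 1 and act by signs on a simple module (`exists_pb_one_smul_eq`). Such
a module is therefore a line, multiplication of coordinates is an invariant form on it, and ∑ Λ₁Λ₂ =
1 makes the indicator equal to the dimension 1. -/

namespace Bismash

/-! ### One-dimensional modules from characters of F -/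

section Character
variable {k : Type*} [Field k] {F G : Type*} [Group F] [Group G] [Fintype G]
  (P : MatchedPair F G)

open Classical in
/-- The character `p_x # b ↦ δ_{x,1} φ(b)` of `k^G # kF` attached to a character `φ` of `F`. -/
noncomputable def charHom (φ : F →* kˣ) : Bismash k P →ₐ[k] k :=
  have hpb : ∀ x a, (basis k P).constr k
      (fun s => if s.1 = 1 then (φ s.2 : k) else 0) (pb k P x a) = if x = 1 then (φ a : k) else 0 :=
    fun x a => (basis k P).constr_basis k _ (x, a)
  AlgHom.ofLinearMap ((basis k P).constr k fun s => if s.1 = 1 then (φ s.2 : k) else 0)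
    (by simp [one_eq, hpb])
    (by
      intro u v
      induction u using induction_pb with
      | h0 => simp only [zero_mul, map_zero]
      | hadd u u' hu hu' => simp only [add_mul, map_add, hu, hu']
      | hb c x a =>
      induction v using induction_pb with
      | h0 => simp only [mul_zero, map_zero]
      | hadd u u' hu hu' => simp only [mul_add, map_add, hu, hu']
      | hb d y b =>
      simp only [smul_mul_assoc, mul_smul_comm, map_smul, pb_mul_pb, hpb]
      -- If x = 1, then `P.lhd 1 a = 1`, so the product is nonzero only for y = 1, where φ is
      -- multiplicative. If x ≠ 1, both sides vanish.
      by_cases hx : x = 1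
      · subst hx
        by_cases hy : y = 1 <;> simp [hy, P.one_lhd, hpb]
      · by_cases h : y = P.lhd x a <;> simp [h, hx, hpb])

open Classical in
theorem charHom_pb (φ : F →* kˣ) (x : G) (a : F) :
    charHom P φ (pb k P x a) = if x = 1 then (φ a : k) else 0 :=
  (basis k P).constr_basis k _ (x, a)

/-- In Δ(p_1 # a) every summand with y ≠ 1 is killed by the character, so on what remains p_1 # a
behaves like a group-like element. -/
theorem charHom_mul'_comul_pb_one (φ : F →* kˣ) (a : F) :
    charHom P φ (LinearMap.mul' k _ (Coalgebra.comul (R := k) (pb k P 1 a))) =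
      (φ (a * a) : k) := by
  classical
  simp only [comul_pb, map_sum, LinearMap.mul'_apply, map_mul, charHom_pb]
  rw [Finset.sum_eq_single 1]
  · simp [P.one_rhd]
  · intro y _ hy
    simp [hy]
  · simp

/-- The field `k` as a module over `k^G # kF` through the character attached to `φ`. -/
noncomputable abbrev charModule (φ : F →* kˣ) : Module (Bismash k P) k :=
  Module.compHom k (charHom P φ).toRingHom

theorem charModule_isScalarTower (φ : F →* kˣ) :
    let := charModule P φ
    IsScalarTower k (Bismash k P) k := by
  let := charModule P φ
  refine ⟨fun c h m => ?_⟩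
  change charHom P φ (c • h) * m = c * (charHom P φ h * m)
  rw [map_smul, smul_eq_mul, mul_assoc]

theorem charModule_isSimpleModule (φ : F →* kˣ) :
    let := charModule P φ
    IsSimpleModule (Bismash k P) k := by
  let := charModule P φ
  rw [isSimpleModule_iff_toSpanSingleton_surjective]
  refine ⟨inferInstance, fun m hm c => ⟨algebraMap k _ (c * m⁻¹), ?_⟩⟩
  change charHom P φ (algebraMap k _ (c * m⁻¹)) * m = c
  rw [AlgHom.commutes]
  simp [hm]

end Character

/-! ### Both properties force φ² = 1 -/

section SelfDual
variable {k : Type u} [Field k] {F G : Type} [Group F] [Group G] [Fintype G]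
  {P : MatchedPair F G}

/-- If `k^G # kF` is totally orthogonal, then every character of `F` is its own inverse. -/
theorem apply_mul_self_of_isTotallyOrthogonal (h : IsTotallyOrthogonal k (Bismash k P))
    (φ : F →* kˣ) (a : F) : φ (a * a) = 1 := by
  classical
  let := charModule P φ
  have := charModule_isScalarTower P φ
  have := charModule_isSimpleModule P φ
  -- F and G lie in `Type`, so the algebra lies in the universe of k and k itself is an admissible
  -- module.
  obtain ⟨B, hB, -, hnd⟩ := h k
  have smul_def : ∀ (u : Bismash k P) (m : k), u • m = charHom P φ u * m := fun _ _ => rfl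
  have hB1 : B 1 1 ≠ 0 := by
    intro h0
    refine one_ne_zero (hnd.1 (1 : k) fun w => ?_)
    rw [← mul_one w, ← smul_eq_mul, map_smul, h0, smul_zero]
  have key := hB (pb k P 1 a) 1 1
  rw [comul_pb, map_sum, counit_pb, Finset.sum_eq_single 1] at key
  -- Only the summand y = 1 is left; it turns invariance at (1, 1) into φ(a)² B(1, 1) = B(1, 1).
  · have e : ∀ c : k, B c c = c * c * B 1 1 := by
      intro c
      have : B (c • 1) (c • 1) = c * c * B 1 1 := by
        rw [map_smul, map_smul, LinearMap.smul_apply, smul_eq_mul, smul_eq_mul, mul_assoc]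
      simpa using this
    simp only [P.one_rhd, inv_one, mul_one, TensorProduct.lift.tmul, LinearMap.compl₁₂_apply,
      LinearMap.coe_restrictScalars, LinearMap.toSpanSingleton_apply, smul_def, charHom_pb,
      if_true, e (φ a)] at key
    have := mul_right_cancel₀ hB1 key
    refine Units.ext ?_
    simpa using this
  · intro y _ hy
    simp [LinearMap.compl₁₂_apply, smul_def, charHom_pb, hy]
  · simp

/-- If all simple `k^G # kF`-modules have indicator `+1`, then every character of `F` is its own
inverse. -/
theorem apply_mul_self_of_allIndicatorsOne [Fintype F] (hF : (Fintype.card F : k) ≠ 0)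
    (h : AllIndicatorsOne k (Bismash k P)) (φ : F →* kˣ) (a : F) : φ (a * a) = 1 := by
  classical
  let := charModule P φ
  have := charModule_isScalarTower P φ
  have := charModule_isSimpleModule P φ
  have key := h k
  by_contra hne
  -- ψ = φ² is viewed with values in k; being nontrivial, it sums to zero over F.
  let ψ : F →* k := (Units.coeHom k).comp (φ * φ)
  have hψ : ψ ≠ 1 := by
    intro h1
    refine hne (Units.ext ?_)
    simpa [ψ] using DFunLike.congr_fun h1 a
  have smul_eq : ∀ u : Bismash k P, Algebra.lsmul k k k u = charHom P φ u • LinearMap.id :=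
    fun u => LinearMap.ext fun m => rfl
  rw [frobeniusSchurIndicator, (isNormalizedIntegral k P hF).eq_normalizedIntegral, smul_eq,
    map_smul, LinearMap.trace_id, Module.finrank_self, map_smul, map_smul, map_smul,
    map_sum, map_sum, map_sum] at key
  simp only [charHom_mul'_comul_pb_one] at key
  have h0 : ∑ a : F, (φ (a * a) : k) = 0 := by
    simpa [ψ] using sum_hom_units_eq_zero ψ hψ
  rw [h0, smul_zero, zero_smul] at key
  exact zero_ne_one key

end SelfDual

/-! ### Trivial G and F of exponent two: the group algebra of F -/

section TrivialFactor
variable {k : Type*} [Field k] {F G : Type*} [Group F] [Group G]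
  {P : MatchedPair F G} [Subsingleton G]

theorem pb_one_mul_pb_one (a b : F) : pb k P 1 a * pb k P 1 b = pb k P 1 (a * b) := by
  classical
  rw [pb_mul_pb, if_pos (Subsingleton.elim _ _)]

variable [Fintype G]

theorem one_eq_pb_one : (1 : Bismash k P) = pb k P 1 1 := by
  rw [one_eq, Fintype.sum_subsingleton _ 1]

theorem comul_pb_one (a : F) :
    Coalgebra.comul (R := k) (pb k P 1 a) = pb k P 1 a ⊗ₜ[k] pb k P 1 a := by
  rw [comul_pb, Fintype.sum_subsingleton _ 1, P.one_rhd, inv_one, mul_one]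

/-- A group in which every element squares to 1 is commutative, so its group algebra is too. -/
theorem pb_one_mul_comm (hF : ∀ a : F, a * a = 1) (a : F) (u : Bismash k P) :
    pb k P 1 a * u = u * pb k P 1 a := by
  induction u using induction_pb with
  | h0 => simp only [zero_mul, mul_zero]
  | hadd u u' hu hu' => simp only [add_mul, mul_add, hu, hu']
  | hb c x b =>
    rw [Subsingleton.elim x 1, smul_mul_assoc, mul_smul_comm, pb_one_mul_pb_one,
      pb_one_mul_pb_one, (Commute.of_orderOf_dvd_two (fun c => orderOf_dvd_of_pow_eq_one
        ((sq c).trans (hF c))) a b).eq]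

variable {M : Type*} [AddCommGroup M] [Module k M] [Module (Bismash k P) M]

/-- On a simple module, every group-like element `p_1 # a` of order two acts by a sign. -/
theorem exists_pb_one_smul_eq [IsSimpleModule (Bismash k P) M]
    (hF : ∀ a : F, a * a = 1) (a : F) :
    ∃ c : k, c * c = 1 ∧ ∀ m : M, pb k P 1 a • m = c • m := by
  -- The fixed vectors of g = p_1 # a form a submodule because g is central; simplicity leaves only
  -- 0 or everything. This replaces Schur's lemma and needs neither algebraic closure nor finite
  -- dimension.
  let N : Submodule (Bismash k P) M :=
    { carrier := {m | pb k P 1 a • m = m}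
      add_mem' := fun {x y} hx hy => by
        simp only [Set.mem_ofPred_eq] at hx hy ⊢
        rw [smul_add, hx, hy]
      zero_mem' := smul_zero _
      smul_mem' := fun u x hx => by
        simp only [Set.mem_ofPred_eq] at hx ⊢
        rw [← mul_smul, pb_one_mul_comm hF, mul_smul, hx] }
  rcases eq_bot_or_eq_top N with h | h
  · refine ⟨-1, by ring, fun m => ?_⟩
    -- Since g² = 1, the vector m + gm is fixed; when there are no nonzero fixed vectors it is 0, so
    -- g acts by -1.
    have hm : m + pb k P 1 a • m ∈ N := by
      change pb k P 1 a • (m + pb k P 1 a • m) = m + pb k P 1 a • m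
      rw [smul_add, ← mul_smul, pb_one_mul_pb_one, hF, ← one_eq_pb_one, one_smul, add_comm]
    rw [h, Submodule.mem_bot] at hm
    rw [neg_one_smul]
    exact (neg_eq_of_add_eq_zero_right hm).symm
  · refine ⟨1, one_mul 1, fun m => ?_⟩
    have hm : m ∈ N := h ▸ Submodule.mem_top
    rw [one_smul]
    exact hm

theorem exists_smul_eq [IsScalarTower k (Bismash k P) M]
    [IsSimpleModule (Bismash k P) M] (hF : ∀ a : F, a * a = 1) (u : Bismash k P) :
    ∃ c : k, ∀ m : M, u • m = c • m := by
  induction u using induction_pb with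
  | h0 => exact ⟨0, fun m => by rw [zero_smul, zero_smul]⟩
  | hadd u v hu hv =>
    obtain ⟨c, hc⟩ := hu
    obtain ⟨d, hd⟩ := hv
    exact ⟨c + d, fun m => by rw [add_smul, add_smul, hc, hd]⟩
  | hb e x a =>
    obtain ⟨c, -, hc⟩ := exists_pb_one_smul_eq (k := k) (P := P) (M := M) hF a
    exact ⟨e * c, fun m => by rw [Subsingleton.elim x 1, smul_assoc, hc, mul_smul]⟩

variable (P) in
-- Any nonzero vector generates a simple module, and the whole algebra acts by scalars, so that
-- vector already spans it over k.
theorem finrank_eq_one_of_isSimpleModule [IsScalarTower k (Bismash k P) M]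
    [IsSimpleModule (Bismash k P) M] (hF : ∀ a : F, a * a = 1) : Module.finrank k M = 1 := by
  obtain ⟨hM, hs⟩ := isSimpleModule_iff_toSpanSingleton_surjective.mp
    (inferInstance : IsSimpleModule (Bismash k P) M)
  obtain ⟨v, hv⟩ := exists_ne (0 : M)
  refine finrank_eq_one v hv fun w => ?_
  obtain ⟨u, hu⟩ := hs v hv w
  obtain ⟨c, hc⟩ := exists_smul_eq (k := k) (P := P) (M := M) hF u
  exact ⟨c, (hc v).symm.trans hu⟩

theorem exists_isInvariantForm_isSymm_nondegenerate [IsScalarTower k (Bismash k P) M]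
    [IsSimpleModule (Bismash k P) M] (hF : ∀ a : F, a * a = 1) :
    ∃ B : LinearMap.BilinForm k M,
      IsInvariantForm k (Bismash k P) B ∧ B.IsSymm ∧ B.Nondegenerate := by
  classical
  have h1 := finrank_eq_one_of_isSimpleModule (k := k) P (M := M) hF
  have : FiniteDimensional k M := Module.finite_of_finrank_eq_succ h1
  let e : M ≃ₗ[k] k := LinearEquiv.ofFinrankEq M k (h1.trans (Module.finrank_self k).symm)
  let B : LinearMap.BilinForm k M := (LinearMap.mul k k).compl₁₂ (e : M →ₗ[k] k) (e : M →ₗ[k] k)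
  have hB : ∀ v w, B v w = e v * e w := fun v w => rfl
  have hsymm : B.IsSymm := ⟨fun v w => mul_comm (e v) (e w)⟩
  refine ⟨B, fun h v w => ?_, hsymm, fun v hv => ?_, fun v hv => ?_⟩
  · induction h using induction_pb with
    | h0 => simp only [map_zero, zero_mul]
    | hadd u u' hu hu' => simp only [map_add, add_mul, hu, hu']
    | hb c x a =>
      -- The group-like element scales both arguments of B by d, and d² = 1 matches its counit 1.
      obtain ⟨d, hd, hda⟩ := exists_pb_one_smul_eq (k := k) (P := P) (M := M) hF a
      rw [Subsingleton.elim x 1, map_smul, map_smul, map_smul, comul_pb_one, counit_pb, if_pos rfl,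
        TensorProduct.lift.tmul, LinearMap.compl₁₂_apply]
      simp only [LinearMap.coe_restrictScalars, LinearMap.toSpanSingleton_apply, hda, map_smul,
        LinearMap.smul_apply, smul_eq_mul, mul_one]
      rw [← mul_assoc d d, hd, one_mul]
  · simpa [hB] using hv (e.symm 1)
  · simpa [hB] using hv (e.symm 1)

theorem frobeniusSchurIndicator_eq_one [IsScalarTower k (Bismash k P) M]
    [IsSimpleModule (Bismash k P) M] [Fintype F] (hF : ∀ a : F, a * a = 1)
    (hcard : (Fintype.card F : k) ≠ 0) :
    frobeniusSchurIndicator k (Bismash k P) M = 1 := by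
  have h1 := finrank_eq_one_of_isSimpleModule (k := k) P (M := M) hF
  have : FiniteDimensional k M := Module.finite_of_finrank_eq_succ h1
  -- Each group-like summand of Λ contributes its square, which is 1, so the average ∑ Λ₁Λ₂ is 1.
  have h2 : LinearMap.mul' k (Bismash k P) (Coalgebra.comul (R := k)
      (normalizedIntegral k (Bismash k P))) = 1 := by
    rw [(isNormalizedIntegral k P hcard).eq_normalizedIntegral, map_smul, map_smul, map_sum,
      map_sum]
    simp only [comul_pb_one, LinearMap.mul'_apply, pb_one_mul_pb_one, hF, ← one_eq_pb_one,
      Finset.sum_const, Finset.card_univ]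
    rw [← Nat.cast_smul_eq_nsmul k, smul_smul, inv_mul_cancel₀ hcard, one_smul]
  rw [frobeniusSchurIndicator, h2, map_one, LinearMap.trace_one, h1, Nat.cast_one]

end TrivialFactor

end Bismash

/-! ### The factors of S_n: the case n = 2 and characters of C_n -/

theorem stdCycle_mul_self_eq_one_iff (n : ℕ) : stdCycle n * stdCycle n = 1 ↔ n ∣ 2 := by
  have h : ∀ i, (stdCycle n * stdCycle n) i = i + 2 := fun i => by
    have := stdCycle_zpow_apply n 2 i
    rwa [zpow_two, Int.cast_ofNat] at this
  rw [← ZMod.natCast_eq_zero_iff]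
  constructor
  · intro e
    have := h 0
    rw [e, Equiv.Perm.one_apply, zero_add] at this
    exact_mod_cast this.symm
  · intro e
    ext1 i
    rw [h, Equiv.Perm.one_apply]
    have e' : (2 : ZMod n) = 0 := by exact_mod_cast e
    rw [e', add_zero]

theorem cyclicSubgroup_two_mul_self (a : cyclicSubgroup 2) : a * a = 1 := by
  obtain ⟨_, r, rfl⟩ := a
  refine Subtype.ext ?_
  change stdCycle 2 ^ r * stdCycle 2 ^ r = 1
  rw [← (Commute.refl (stdCycle 2)).mul_zpow, (stdCycle_mul_self_eq_one_iff 2).mpr dvd_rfl,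
    one_zpow]

theorem subsingleton_pointStabilizer_two : Subsingleton (pointStabilizer 2) := by
  have key : ∀ σ : Equiv.Perm (ZMod 2), σ 0 = 0 → σ = 1 := by decide
  exact ⟨fun x y => Subtype.ext ((key x x.2).trans (key y y.2).symm)⟩

/-- For `n > 2` the cyclic group `C_n` has a character that is not its own inverse. -/
theorem exists_character_mul_self_ne_one (k : Type*) [Field k] [IsAlgClosed k] [CharZero k]
    {n : ℕ} [NeZero n] (hn : 2 < n) :
    ∃ (φ : cyclicSubgroup n →* kˣ) (a : cyclicSubgroup n), φ (a * a) ≠ 1 := by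
  let a : cyclicSubgroup n := ⟨stdCycle n, Subgroup.mem_zpowers _⟩
  have ha : a * a ≠ 1 := fun h => by
    have := (stdCycle_mul_self_eq_one_iff n).mp (congrArg Subtype.val h)
    exact absurd (Nat.le_of_dvd two_pos this) (by omega)
  let _ : CommGroup (cyclicSubgroup n) :=
    { (inferInstance : Group (cyclicSubgroup n)) with
      mul_comm := by
        rintro ⟨_, r, rfl⟩ ⟨_, s, rfl⟩
        exact Subtype.ext (((Commute.refl (stdCycle n)).zpow_zpow r s).eq) }
  have : NeZero (Monoid.exponent (cyclicSubgroup n)) :=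
    ⟨Monoid.exponent_ne_zero_of_finite⟩
  -- An algebraically closed field in which the exponent is invertible has enough roots of unity, so
  -- characters separate a² from 1.
  have : NeZero (Monoid.exponent (cyclicSubgroup n) : k) := NeZero.charZero
  obtain ⟨φ, hφ⟩ := CommGroup.exists_apply_ne_one_of_hasEnoughRootsOfUnity
    (cyclicSubgroup n) k ha
  exact ⟨φ, a, hφ⟩

theorem mainTheorem6 {k : Type*} [Field k] [IsAlgClosed k] [CharZero k]
    (n : ℕ) [NeZero n] (hn : 2 ≤ n) :
    (IsTotallyOrthogonal k (HopfJ n k) ↔ n = 2) ∧ (AllIndicatorsOne k (HopfJ n k) ↔ n = 2) := by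
  have hcard : ∀ (m : ℕ) [NeZero m], (Fintype.card (cyclicSubgroup m) : k) ≠ 0 := fun m _ =>
    Nat.cast_ne_zero.mpr Fintype.card_ne_zero
  refine ⟨⟨fun h => ?_, ?_⟩, ⟨fun h => ?_, ?_⟩⟩
  · by_contra hne
    obtain ⟨φ, a, hφ⟩ := exists_character_mul_self_ne_one k (lt_of_le_of_ne hn (Ne.symm hne))
    exact hφ (Bismash.apply_mul_self_of_isTotallyOrthogonal h φ a)
  · rintro rfl
    have := subsingleton_pointStabilizer_two
    intro M _ _ _ _ _
    exact Bismash.exists_isInvariantForm_isSymm_nondegenerate cyclicSubgroup_two_mul_self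
  · by_contra hne
    obtain ⟨φ, a, hφ⟩ := exists_character_mul_self_ne_one k (lt_of_le_of_ne hn (Ne.symm hne))
    exact hφ (Bismash.apply_mul_self_of_allIndicatorsOne (hcard n) h φ a)
  · rintro rfl
    have := subsingleton_pointStabilizer_two
    intro M _ _ _ _ _
    exact Bismash.frobeniusSchurIndicator_eq_one cyclicSubgroup_two_mul_self (hcard 2)
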